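/- Let $n,m,p,l\ge 0$ be integers and let $f,g_1,\dots,g_m,h_1,\dots,h_p,G_1,\dots,G_l,H_1,\dots,H_l:\mathbb{R}^n\to\mathbb{R}$ be twice continuously differentiable. Consider the mathematical program with switching constraints $$\text{(MPSC)}\qquad \min f(x)\quad\text{s.t.}\quad g_i(x)\le 0\ (1\le i\le m),\quad h_j(x)=0\ (1\le j\le p),\quad G_k(x)H_k(x)=0\ (1\le k\le l),$$ with feasible set $\mathcal{F}$, and let $\bar x\in\mathcal{F}$. Put $\mathcal{I}_g=\{i: g_i(\bar x)=0\}$, $\mathcal{I}_G=\{k: G_k(\bar x)=0,\ H_k(\bar x)\ne 0\}$, $\mathcal{I}_H=\{k: G_k(\bar x)\ne 0,\ H_k(\bar x)=0\}$, $\mathcal{I}_{GH}=\{k: G_k(\bar x)=H_k(\bar x)=0\}$, and let $\mathcal{P}(\mathcal{I}_{GH})$ be the set of all pairs $(\beta_1,\beta_2)$ of disjoint (possibly empty) sets with $\beta_1\cup\beta_2=\mathcal{I}_{GH}$. *MPSC-PWCR* (piecewise weak constant rank) holds at $\bar x$ if for each $(\beta_1,\beta_2)\in\mathcal{P}(\mathcal{I}_{GH})$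 there is $\varepsilon>0$ such that the rank of the family of gradients $$\{\nabla g_i(x)\}_{i\in\mathcal{I}_g}\cup\{\nabla h_j(x)\}_{1\le j\le p}\cup\{\nabla G_k(x)\}_{k\in\mathcal{I}_G\cup\beta_1}\cup\{\nabla H_k(x)\}_{k\in\mathcal{I}_H\cup\beta_2}$$ is constant for all $x$ with $\|x-\bar x\|<\varepsilon$. *MPSC-PSOQN* (piecewise second-order quasi-normality) holds at $\bar x$ if for each $(\beta_1,\beta_2)\in\mathcal{P}(\mathcal{I}_{GH})$ there is no nonzero vector $(\lambda,\rho,\mu,\nu)\in\mathbb{R}^m\times\mathbb{R}^p\times\mathbb{R}^{\mathcal{I}_G\cup\beta_1}\times\mathbb{R}^{\mathcal{I}_H\cup\beta_2}$ with $\lambda\ge 0$ such that the following three conditions hold: 1. $\sum_{i=1}^m\lambda_i\nabla g_i(\bar x)+\sum_{j=1}^p\rho_j\nabla h_j(\bar x)+\sum_{k\in\mathcal{I}_G\cup\beta_1}\mu_k\nabla G_k(\bar x)+\sum_{k\in\mathcal{I}_H\cup\beta_2}\nu_k\nabla H_k(\bar x)=0$; 2. $d^\top\Big(\sum_{i=1}^m\lambda_i\nabla^2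 g_i(\bar x)+\sum_{j=1}^p\rho_j\nabla^2 h_j(\bar x)+\sum_{k\in\mathcal{I}_G\cup\beta_1}\mu_k\nabla^2 G_k(\bar x)+\sum_{k\in\mathcal{I}_H\cup\beta_2}\nu_k\nabla^2 H_k(\bar x)\Big)d\ge 0$ for every $d\in\mathbb{R}^n$ with $\nabla g_i(\bar x)^\top d=0$ $(i\in\mathcal{I}_g)$, $\nabla h_j(\bar x)^\top d=0$ $(1\le j\le p)$, $\nabla G_k(\bar x)^\top d=0$ $(k\in\mathcal{I}_G\cup\beta_1)$ and $\nabla H_k(\bar x)^\top d=0$ $(k\in\mathcal{I}_H\cup\beta_2)$; 3. there is a sequence $x^s\to\bar x$ such that for every $s$ and all indices in the respective ranges: $\lambda_i>0\Rightarrow\lambda_i g_i(x^s)>0$; $\rho_j\ne 0\Rightarrow\rho_j h_j(x^s)>0$; $\mu_k\ne 0\Rightarrow\mu_k G_k(x^s)>0$; $\nu_k\ne 0\Rightarrow\nu_k H_k(x^s)>0$. **Theorem.** If MPSC-PWCR and MPSC-PSOQN hold at $\bar x\in\mathcal{F}$, then the local error bound of (MPSC) holds at $\bar x$: there exist $\varepsilon,\alpha>0$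 such that for all $x$ with $\|x-\bar x\|<\varepsilon$ $$\inf_{y\in\mathcal{F}}\|x-y\|\le\alpha\Big(\sum_{i=1}^m\max\{g_i(x),0\}^2+\sum_{j=1}^p h_j(x)^2+\sum_{k=1}^l\min\{G_k(x)^2,H_k(x)^2\}\Big)^{1/2}.$$ -/

import Mathlib

open scoped Gradient

/-- A mathematical program with switching constraints in `ℝⁿ`:
minimize `f x` subject to `g i x ≤ 0`, `h j x = 0` and `G k x * H k x = 0`,
all the functions being twice continuously differentiable. -/
structure MPSC (n m p l : ℕ) where
  f : EuclideanSpace ℝ (Fin n) → ℝ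
  g : Fin m → EuclideanSpace ℝ (Fin n) → ℝ
  h : Fin p → EuclideanSpace ℝ (Fin n) → ℝ
  G : Fin l → EuclideanSpace ℝ (Fin n) → ℝ
  H : Fin l → EuclideanSpace ℝ (Fin n) → ℝ
  contDiff_f : ContDiff ℝ 2 f
  contDiff_g : ∀ i, ContDiff ℝ 2 (g i)
  contDiff_h : ∀ j, ContDiff ℝ 2 (h j)
  contDiff_G : ∀ k, ContDiff ℝ 2 (G k)
  contDiff_H : ∀ k, ContDiff ℝ 2 (H k)

namespace MPSC

/-- The Hessian of `φ` at `x`, as a linear operator: the derivative of the gradient map. -/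
noncomputable def hessian {n : ℕ} (φ : EuclideanSpace ℝ (Fin n) → ℝ)
    (x : EuclideanSpace ℝ (Fin n)) :
    EuclideanSpace ℝ (Fin n) →L[ℝ] EuclideanSpace ℝ (Fin n) :=
  fderiv ℝ (fun y => ∇ φ y) x

/-- The feasible set. -/
def feasible {n m p l : ℕ} (P : MPSC n m p l) : Set (EuclideanSpace ℝ (Fin n)) :=
  {x | (∀ i, P.g i x ≤ 0) ∧ (∀ j, P.h j x = 0) ∧ (∀ k, P.G k x * P.H k x = 0)}

/-- The inequality constraints that are active at `x₀`. -/
def Ig {n m p l : ℕ} (P : MPSC n m p l) (x₀ : EuclideanSpace ℝ (Fin n)) : Set (Fin m) :=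
  {i | P.g i x₀ = 0}

/-- The switching constraints of which only the factor `G k` vanishes at `x₀`. -/
def IG {n m p l : ℕ} (P : MPSC n m p l) (x₀ : EuclideanSpace ℝ (Fin n)) : Set (Fin l) :=
  {k | P.G k x₀ = 0 ∧ P.H k x₀ ≠ 0}

/-- The switching constraints of which only the factor `H k` vanishes at `x₀`. -/
def IH {n m p l : ℕ} (P : MPSC n m p l) (x₀ : EuclideanSpace ℝ (Fin n)) : Set (Fin l) :=
  {k | P.G k x₀ ≠ 0 ∧ P.H k x₀ = 0}

/-- The switching constraints of which both factors vanish at `x₀`. -/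
def IGH {n m p l : ℕ} (P : MPSC n m p l) (x₀ : EuclideanSpace ℝ (Fin n)) : Set (Fin l) :=
  {k | P.G k x₀ = 0 ∧ P.H k x₀ = 0}

/-- `(β₁, β₂)` is a disjoint bipartition of `IGH`; either part may be empty. It determines the
branch problem with the constraints `g i ≤ 0`, `h j = 0`, `G k = 0` for `k ∈ IG ∪ β₁` and
`H k = 0` for `k ∈ IH ∪ β₂`. -/
def IsBipartition {n m p l : ℕ} (P : MPSC n m p l) (x₀ : EuclideanSpace ℝ (Fin n))
    (β₁ β₂ : Set (Fin l)) : Prop :=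
  β₁ ∪ β₂ = P.IGH x₀ ∧ Disjoint β₁ β₂

/-- The gradients at `x` of the constraints of the branch problem `(β₁, β₂)` that are active
at `x₀`. -/
def branchGradients {n m p l : ℕ} (P : MPSC n m p l) (x₀ : EuclideanSpace ℝ (Fin n))
    (β₁ β₂ : Set (Fin l)) (x : EuclideanSpace ℝ (Fin n)) : Set (EuclideanSpace ℝ (Fin n)) :=
  (fun i => ∇ (P.g i) x) '' P.Ig x₀ ∪ Set.range (fun j => ∇ (P.h j) x) ∪
    (fun k => ∇ (P.G k) x) '' (P.IG x₀ ∪ β₁) ∪ (fun k => ∇ (P.H k) x) '' (P.IH x₀ ∪ β₂)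

/-- The weak constant rank condition of the branch problem `(β₁, β₂)` at `x₀`. -/
def BranchWCR {n m p l : ℕ} (P : MPSC n m p l) (x₀ : EuclideanSpace ℝ (Fin n))
    (β₁ β₂ : Set (Fin l)) : Prop :=
  ∃ ε > 0, ∃ r : ℕ, ∀ x ∈ Metric.ball x₀ ε, Set.finrank ℝ (P.branchGradients x₀ β₁ β₂ x) = r

/-- MPSC piecewise weak constant rank condition. -/
def PWCR {n m p l : ℕ} (P : MPSC n m p l) (x₀ : EuclideanSpace ℝ (Fin n)) : Prop :=
  ∀ β₁ β₂ : Set (Fin l), P.IsBipartition x₀ β₁ β₂ → P.BranchWCR x₀ β₁ β₂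

/-- The critical subspace of the branch problem `(β₁, β₂)` at `x₀`. -/
def branchCriticalSubspace {n m p l : ℕ} (P : MPSC n m p l) (x₀ : EuclideanSpace ℝ (Fin n))
    (β₁ β₂ : Set (Fin l)) : Set (EuclideanSpace ℝ (Fin n)) :=
  {d | (∀ i ∈ P.Ig x₀, inner ℝ (∇ (P.g i) x₀) d = 0) ∧
    (∀ j, inner ℝ (∇ (P.h j) x₀) d = 0) ∧
    (∀ k ∈ P.IG x₀ ∪ β₁, inner ℝ (∇ (P.G k) x₀) d = 0) ∧
    (∀ k ∈ P.IH x₀ ∪ β₂, inner ℝ (∇ (P.H k) x₀) d = 0)}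

/-- The multipliers that second-order quasi-normality of the branch problem `(β₁, β₂)` excludes,
apart from the zero one. The branch problem has the multipliers `μ k` for `k ∈ IG ∪ β₁` and `ν k`
for `k ∈ IH ∪ β₂` only; the remaining components are set to zero, so that sums over these index
sets are sums over all `k`. -/
structure IsBranchSOQNMultiplier {n m p l : ℕ} (P : MPSC n m p l)
    (x₀ : EuclideanSpace ℝ (Fin n)) (β₁ β₂ : Set (Fin l))
    (lam : Fin m → ℝ) (ρ : Fin p → ℝ) (μ ν : Fin l → ℝ) : Prop where
  supp_μ : ∀ k, k ∉ P.IG x₀ ∪ β₁ → μ k = 0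
  supp_ν : ∀ k, k ∉ P.IH x₀ ∪ β₂ → ν k = 0
  nonneg : ∀ i, 0 ≤ lam i
  first_order : ∑ i, lam i • ∇ (P.g i) x₀ + ∑ j, ρ j • ∇ (P.h j) x₀
    + ∑ k, μ k • ∇ (P.G k) x₀ + ∑ k, ν k • ∇ (P.H k) x₀ = 0
  second_order : ∀ d ∈ P.branchCriticalSubspace x₀ β₁ β₂,
    0 ≤ inner ℝ d ((∑ i, lam i • hessian (P.g i) x₀ + ∑ j, ρ j • hessian (P.h j) x₀
      + ∑ k, μ k • hessian (P.G k) x₀ + ∑ k, ν k • hessian (P.H k) x₀) d)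
  sequence : ∃ x : ℕ → EuclideanSpace ℝ (Fin n),
    Filter.Tendsto x Filter.atTop (nhds x₀) ∧
    ∀ s, (∀ i, 0 < lam i → 0 < lam i * P.g i (x s)) ∧
      (∀ j, ρ j ≠ 0 → 0 < ρ j * P.h j (x s)) ∧
      (∀ k, μ k ≠ 0 → 0 < μ k * P.G k (x s)) ∧
      (∀ k, ν k ≠ 0 → 0 < ν k * P.H k (x s))

/-- Second-order quasi-normality of the branch problem `(β₁, β₂)` at `x₀`. -/
def BranchSOQN {n m p l : ℕ} (P : MPSC n m p l) (x₀ : EuclideanSpace ℝ (Fin n))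
    (β₁ β₂ : Set (Fin l)) : Prop :=
  ¬ ∃ (lam : Fin m → ℝ) (ρ : Fin p → ℝ) (μ ν : Fin l → ℝ),
    (lam, ρ, μ, ν) ≠ 0 ∧ P.IsBranchSOQNMultiplier x₀ β₁ β₂ lam ρ μ ν

/-- MPSC piecewise second-order quasi-normality. -/
def PSOQN {n m p l : ℕ} (P : MPSC n m p l) (x₀ : EuclideanSpace ℝ (Fin n)) : Prop :=
  ∀ β₁ β₂ : Set (Fin l), P.IsBipartition x₀ β₁ β₂ → P.BranchSOQN x₀ β₁ β₂

/-- The constraint violation that bounds the distance to the feasible set. -/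
noncomputable def residual {n m p l : ℕ} (P : MPSC n m p l) (x : EuclideanSpace ℝ (Fin n)) : ℝ :=
  Real.sqrt (∑ i, (max (P.g i x) 0) ^ 2 + ∑ j, (P.h j x) ^ 2
    + ∑ k, min ((P.G k x) ^ 2) ((P.H k x) ^ 2))

/-- The local error bound at `x₀`. -/
def LocalErrorBound {n m p l : ℕ} (P : MPSC n m p l) (x₀ : EuclideanSpace ℝ (Fin n)) : Prop :=
  ∃ ε > 0, ∃ α > 0, ∀ x ∈ Metric.ball x₀ ε, Metric.infDist x P.feasible ≤ α * P.residual x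

end MPSC

/-! ### Constant rank and the derivative of a linear relation -/

section ConstantRank

open Filter Topology

variable {E ι : Type*} [NormedAddCommGroup E] [InnerProductSpace ℝ E] [FiniteDimensional ℝ E]

/-! Near `x₀` the residual at `x` dominates the violation of one branch problem: for each `k` in
`IGH`, keep whichever of `G k`, `H k` is smaller in absolute value at `x`. Branch feasible sets lie
in `P.feasible` and there are finitely many branches, so an error bound for each branch suffices.

Within a branch, weak constant rank makes the second-order condition on multipliers automatic: it
holds with equality (`inner_sum_fderiv_eq_zero_of_finrank_eq`). Hence second-order quasi-normality
reduces to ordinary quasi-normality.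

Quasi-normality yields the error bound by contradiction (`eventually_infDist_le_of_quasinormal`). If
the bound fails, penalized minimization gives infeasible points tending to `x₀` where the gradient
of the total violation tends to zero. That gradient combines the constraint gradients with a unit
vector of normalized violations as coefficients, and a limit of these vectors is a forbidden
multiplier. -/

/-- If a finite family of vector fields has constant rank near `x₀`, then a linear relation `c`
between its values at `x₀` and a vector `d` orthogonal to these values annihilate the derivative
of the family in the direction `d`. -/
theorem inner_sum_fderiv_eq_zero_of_finrank_eq [Fintype ι] (v : ι → E → E) (s : Set ι) {x₀ : E}
    (hv : ∀ i, DifferentiableAt ℝ (v i) x₀) {r : ℕ}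
    (hr : ∀ᶠ x in 𝓝 x₀, Set.finrank ℝ ((fun i => v i x) '' s) = r)
    {c : ι → ℝ} (hcs : ∀ i, i ∉ s → c i = 0) (hc : ∑ i, c i • v i x₀ = 0)
    {d : E} (hd : ∀ i ∈ s, inner ℝ (v i x₀) d = 0) :
    inner ℝ d (∑ i, c i • fderiv ℝ (v i) x₀ d) = 0 := by
  by_contra hne
  set w : E := ∑ i, c i • fderiv ℝ (v i) x₀ d with hw
  obtain ⟨b, hbS, hbspan, hbli⟩ := exists_linearIndependent ℝ ((fun i => v i x₀) '' s)
  have hbfin : b.Finite := (Set.toFinite _).subset hbS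
  have : Fintype b := hbfin.fintype
  have hidx : ∀ y : b, ∃ i ∈ s, v i x₀ = y := fun y => hbS y.2
  choose idx hidxs hidxv using hidx
  have hline : HasDerivAt (fun t : ℝ => x₀ + t • d) d 0 := by
    simpa using ((hasDerivAt_id (0 : ℝ)).smul_const d).const_add x₀
  have hx0 : x₀ + (0 : ℝ) • d = x₀ := by simp
  have hder : HasDerivAt (fun t : ℝ => ∑ i, c i • v i (x₀ + t • d)) w 0 := by
    refine HasDerivAt.fun_sum fun i _ => HasDerivAt.const_smul (c i) ?_
    have h1 : HasFDerivAt (v i) (fderiv ℝ (v i) x₀) (x₀ + (0 : ℝ) • d) := by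
      rw [hx0]; exact (hv i).hasFDerivAt
    exact h1.comp_hasDerivAt (0 : ℝ) hline
  -- The relation vanishes at `t = 0`, so its quotient by `t` is a slope tending to `w`. It is
  -- joined to the vectors, moved to `x₀ + t • d`, that form a basis of the span at `x₀`.
  let φ : ℝ → Option b → E := fun t o =>
    o.elim (t⁻¹ • ∑ i, c i • v i (x₀ + t • d)) (fun y => v (idx y) (x₀ + t • d))
  let φ₀ : Option b → E := fun o => o.elim w (fun y => (y : E))
  have hline' : Tendsto (fun t : ℝ => x₀ + t • d) (𝓝[≠] 0) (𝓝 x₀) := by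
    have := hline.continuousAt.tendsto
    rw [hx0] at this
    exact this.mono_left nhdsWithin_le_nhds
  have hlim : Tendsto φ (𝓝[≠] 0) (𝓝 φ₀) := by
    rw [tendsto_pi_nhds]
    rintro (_ | y)
    · have h2 := hasDerivAt_iff_tendsto_slope.1 hder
      refine h2.congr fun t => ?_
      simp [slope, φ, hc]
    · have h2 := (hv (idx y)).continuousAt.tendsto.comp hline'
      rw [hidxv y] at h2
      exact h2
  have hli : LinearIndependent ℝ φ₀ := by
    have h3 : LinearIndependent ℝ fun o : Option b => (o.elim w (fun y => (y : E)) : E) := by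
      rw [show (fun o : Option b => (o.elim w (fun y => (y : E)) : E)) =
        fun o : Option b => Option.casesOn' o w (fun y => (y : E)) from by
          funext o; cases o <;> rfl]
      refine hbli.option ?_
      intro hmem
      -- The span at `x₀` is orthogonal to `d` and `w` is not, so `w` enlarges the basis.
      have hle : Submodule.span ℝ (Set.range fun y : b => (y : E)) ≤ (ℝ ∙ d)ᗮ := by
        rw [Submodule.span_le]
        rintro _ ⟨y, rfl⟩
        simp only [SetLike.mem_coe, Submodule.mem_orthogonal_singleton_iff_inner_left]
        rw [← hidxv y]
        exact hd _ (hidxs y)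
      exact hne (Submodule.mem_orthogonal_singleton_iff_inner_right.1 (hle hmem))
    exact h3
  -- Linear independence is an open condition, so `r + 1` independent vectors persist in a span of
  -- dimension `r`.
  have hev : ∀ᶠ t in 𝓝[≠] (0 : ℝ), LinearIndependent ℝ (φ t) :=
    hlim (isOpen_setOfPred_linearIndependent.mem_nhds hli)
  obtain ⟨t, htli, htr⟩ := (hev.and (hline'.eventually hr)).exists
  have hr0 : Set.finrank ℝ ((fun i => v i x₀) '' s) = r := hr.self_of_nhds
  have hcard0 : Fintype.card b = r := by
    rw [← hr0, Set.finrank, ← hbspan, ← finrank_span_eq_card hbli, Subtype.range_coe]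
  have hcard1 := finrank_span_eq_card htli
  have hsub : Submodule.span ℝ (Set.range (φ t)) ≤
      Submodule.span ℝ ((fun i => v i (x₀ + t • d)) '' s) := by
    rw [Submodule.span_le]
    rintro _ ⟨_ | y, rfl⟩
    · refine Submodule.smul_mem _ _ (Submodule.sum_mem _ fun i _ => ?_)
      by_cases hi : i ∈ s
      · exact Submodule.smul_mem _ _ (Submodule.subset_span ⟨i, hi, rfl⟩)
      · simp [hcs i hi]
    · exact Submodule.subset_span ⟨idx y, hidxs y, rfl⟩
  have hle := Submodule.finrank_mono hsub
  rw [hcard1, Fintype.card_option, hcard0] at hle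
  rw [Set.finrank] at htr
  omega

end ConstantRank

/-! ### Quasi-normality implies the local error bound -/

section ErrorBound

open Filter Topology

variable {E ι : Type*}

open Classical in
/-- The violation of the constraint `t ≤ 0` if `i ∈ I`, and of `t = 0` otherwise. -/
noncomputable def violation (I : Set ι) (i : ι) (t : ℝ) : ℝ := if i ∈ I then max t 0 else t

theorem continuous_violation (I : Set ι) (i : ι) : Continuous (violation I i) := by
  unfold violation; split_ifs <;> fun_prop

theorem violation_nonneg {I : Set ι} {i : ι} (hi : i ∈ I) (t : ℝ) : 0 ≤ violation I i t := by
  simp [violation, hi]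

theorem violation_eq_self {I : Set ι} {i : ι} {t : ℝ} (h : violation I i t ≠ 0) :
    violation I i t = t := by
  unfold violation at *
  split_ifs at * with hi
  · rcases le_total t 0 with ht | ht
    · simp [ht] at h
    · simp [ht]
  · rfl

/-- Squaring removes the kink of `max t 0` at the origin, where the square is `O(t ^ 2)`. -/
theorem hasDerivAt_violation_sq (I : Set ι) (i : ι) (t : ℝ) :
    HasDerivAt (fun t => violation I i t ^ 2) (2 * violation I i t) t := by
  by_cases hi : i ∈ I
  · simp only [violation, hi, if_true]
    rcases lt_trichotomy t 0 with ht | rfl | ht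
    · have : (fun t : ℝ => max t 0 ^ 2) =ᶠ[𝓝 t] fun _ => 0 := by
        filter_upwards [gt_mem_nhds ht] with y hy
        simp [max_eq_right hy.le]
      rw [max_eq_right ht.le, mul_zero]
      exact (hasDerivAt_const t (0 : ℝ)).congr_of_eventuallyEq this
    · rw [hasDerivAt_iff_isLittleO]
      have hO : (fun t : ℝ => max t 0 ^ 2) =O[𝓝 0] fun t => t ^ 2 := by
        refine Asymptotics.isBigO_of_le _ fun t => ?_
        rw [Real.norm_eq_abs, Real.norm_eq_abs, abs_pow, abs_pow]
        refine pow_le_pow_left₀ (abs_nonneg _) ?_ 2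
        rcases le_total t 0 with h | h <;> simp [h]
      simpa using hO.trans_isLittleO (Asymptotics.isLittleO_pow_id one_lt_two)
    · have : (fun t : ℝ => max t 0 ^ 2) =ᶠ[𝓝 t] fun t => t ^ 2 := by
        filter_upwards [lt_mem_nhds ht] with y hy
        rw [max_eq_left hy.le]
      rw [max_eq_left ht.le]
      simpa using (hasDerivAt_pow 2 t).congr_of_eventuallyEq this
  · simpa [violation, hi] using hasDerivAt_pow 2 t

variable [Fintype ι]

/-- The Euclidean norm of the violations of the constraints `F i ≤ 0`, `i ∈ I`, and `F i = 0`,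
`i ∉ I`. -/
noncomputable def totalViolation (I : Set ι) (F : ι → E → ℝ) (x : E) : ℝ :=
  √(∑ i, violation I i (F i x) ^ 2)

theorem totalViolation_nonneg (I : Set ι) (F : ι → E → ℝ) (x : E) : 0 ≤ totalViolation I F x :=
  Real.sqrt_nonneg _

theorem totalViolation_sq (I : Set ι) (F : ι → E → ℝ) (x : E) :
    totalViolation I F x ^ 2 = ∑ i, violation I i (F i x) ^ 2 :=
  Real.sq_sqrt (Finset.sum_nonneg fun _ _ => sq_nonneg _)

theorem continuous_totalViolation [TopologicalSpace E] (I : Set ι) {F : ι → E → ℝ} (hF : ∀ i, Continuous (F i)) :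
    Continuous (totalViolation I F) :=
  Real.continuous_sqrt.comp <| continuous_finsetSum _ fun i _ =>
    ((continuous_violation I i).comp (hF i)).pow 2

theorem totalViolation_eq_zero_iff {I : Set ι} {F : ι → E → ℝ} {x : E} :
    totalViolation I F x = 0 ↔ ∀ i, violation I i (F i x) = 0 := by
  rw [← pow_eq_zero_iff two_ne_zero, totalViolation_sq,
    Finset.sum_eq_zero_iff_of_nonneg fun _ _ => sq_nonneg _]
  simp

variable [NormedAddCommGroup E] [InnerProductSpace ℝ E] [ProperSpace E]

open scoped Gradient

theorem hasGradientAt_totalViolation {I : Set ι} {F : ι → E → ℝ} {x : E}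
    (hF : ∀ i, DifferentiableAt ℝ (F i) x) (hx : totalViolation I F x ≠ 0) :
    HasGradientAt (totalViolation I F)
      (∑ i, (violation I i (F i x) / totalViolation I F x) • ∇ (F i) x) x := by
  have h1 : HasFDerivAt (fun y => ∑ i, violation I i (F i y) ^ 2)
      (∑ i, (2 * violation I i (F i x)) • fderiv ℝ (F i) x) x :=
    HasFDerivAt.fun_sum fun i _ =>
      (hasDerivAt_violation_sq I i (F i x)).comp_hasFDerivAt x (hF i).hasFDerivAt
  have h2 : ∑ i, violation I i (F i x) ^ 2 ≠ 0 := by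
    rw [← totalViolation_sq]; exact pow_ne_zero 2 hx
  have h3 := h1.sqrt h2
  rw [hasGradientAt_iff_hasFDerivAt]
  refine h3.congr_fderiv ?_
  rw [map_sum, Finset.smul_sum]
  refine Finset.sum_congr rfl fun i _ => ?_
  rw [map_smul, gradient, LinearIsometryEquiv.apply_symm_apply, smul_smul]
  congr 1
  change 1 / (2 * totalViolation I F x) * _ = _
  field_simp

/-- A positive continuous function that is small compared with the distance to a set has, close
by, an almost critical point outside that set. -/
theorem exists_norm_gradient_le_of_mul_lt_infDist {φ : E → ℝ} {φ' : E → E} {C : Set E}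
    (hφ : Continuous φ) (hφ0 : ∀ x, 0 ≤ φ x)
    (hφ' : ∀ x, x ∉ C → HasGradientAt φ (φ' x) x) {K : ℝ} (hK : 0 < K) {x : E}
    (hx : K * φ x < Metric.infDist x C) :
    ∃ z, z ∉ C ∧ dist z x ≤ Metric.infDist x C ∧ ‖φ' z‖ ≤ 4 / K := by
  set δ := Metric.infDist x C with hδ
  have hδ0 : 0 < δ := (mul_nonneg hK.le (hφ0 x)).trans_lt hx
  -- With this weight the penalty on the sphere of radius `δ / 2` is `δ / K > φ x`, which forces the
  -- minimizer into the open ball; there the penalty gradient has norm at most `2 * c * (δ / 2) = 4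
  -- / K`.
  set c : ℝ := 4 / (K * δ) with hc
  have hc0 : 0 < c := by positivity
  obtain ⟨z, hzmem, hzmin⟩ := (isCompact_closedBall x (δ / 2)).exists_isMinOn
    ⟨x, Metric.mem_closedBall_self (by positivity)⟩
    (f := fun y => φ y + c * ‖y - x‖ ^ 2) (by fun_prop)
  have hzx : φ z + c * ‖z - x‖ ^ 2 ≤ φ x := by
    simpa using hzmin (Metric.mem_closedBall_self (by positivity : 0 ≤ δ / 2))
  have hzlt : ‖z - x‖ < δ / 2 := by
    refine lt_of_le_of_ne (by simpa [dist_eq_norm] using hzmem) fun heq => ?_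
    rw [heq] at hzx
    have h1 : c * (δ / 2) ^ 2 = δ / K := by rw [hc]; field_simp; norm_num
    have h2 : φ x < δ / K := by rw [lt_div_iff₀ hK]; linarith
    linarith [hφ0 z]
  have hzC : z ∉ C := fun hz => by
    have := Metric.infDist_le_dist_of_mem (x := x) hz
    rw [dist_comm, dist_eq_norm] at this
    linarith
  have hloc : IsLocalMin (fun y => φ y + c * ‖y - x‖ ^ 2) z :=
    hzmin.isLocalMin (Filter.mem_of_superset
      (Metric.isOpen_ball.mem_nhds (by simpa [dist_eq_norm] using hzlt))
      Metric.ball_subset_closedBall)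
  have hder := ((hφ' z hzC).hasFDerivAt).add
    ((((hasFDerivAt_id z).sub_const x).norm_sq).const_mul c)
  have h0 := hloc.hasFDerivAt_eq_zero hder
  have hgrad : φ' z = -((2 * c) • (z - x)) := by
    refine ext_inner_right ℝ fun y => ?_
    have := congrArg (fun L : E →L[ℝ] ℝ => L y) h0
    simp at this
    rw [inner_neg_left, inner_smul_left, inner_sub_left]
    simp
    linarith
  refine ⟨z, hzC, by rw [dist_eq_norm]; linarith, ?_⟩
  rw [hgrad, norm_neg, norm_smul, Real.norm_of_nonneg (by positivity)]
  calc 2 * c * ‖z - x‖ ≤ 2 * c * (δ / 2) := by gcongr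
    _ = 4 / K := by rw [hc]; field_simp

/-- Quasi-normality of the system `F i ≤ 0`, `i ∈ I`, `F i = 0`, `i ∉ I`, implies the local error
bound. -/
theorem eventually_infDist_le_of_quasinormal (I : Set ι) {F : ι → E → ℝ}
    (hF : ∀ i, ContDiff ℝ 1 (F i)) {x₀ : E} (hx₀ : ∀ i, violation I i (F i x₀) = 0)
    (hqn : ∀ c : ι → ℝ, c ≠ 0 → (∀ i ∈ I, 0 ≤ c i) → ∑ i, c i • ∇ (F i) x₀ = 0 →
      ¬ ∃ x : ℕ → E, Tendsto x atTop (𝓝 x₀) ∧ ∀ s i, c i ≠ 0 → 0 < c i * F i (x s)) :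
    ∃ α > 0, ∀ᶠ x in 𝓝 x₀,
      Metric.infDist x {y | ∀ i, violation I i (F i y) = 0} ≤ α * totalViolation I F x := by
  by_contra! hcon
  set C : Set E := {y | ∀ i, violation I i (F i y) = 0} with hC
  have hpos : ∀ x, x ∉ C → totalViolation I F x ≠ 0 := fun x hx h =>
    hx (totalViolation_eq_zero_iff.1 h)
  have hstep : ∀ k : ℕ, ∃ z, z ∉ C ∧ dist z x₀ ≤ 2 / ((k : ℝ) + 1) ∧
      ‖∑ i, (violation I i (F i z) / totalViolation I F z) • ∇ (F i) z‖ ≤ 4 / ((k : ℝ) + 1) := by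
    intro k
    have hk : (0 : ℝ) < (k : ℝ) + 1 := by positivity
    obtain ⟨x, hx, hxball⟩ := ((hcon _ hk).and_eventually
      (Metric.ball_mem_nhds x₀ (one_div_pos.2 hk))).exists
    obtain ⟨z, hzC, hzx, hz⟩ := exists_norm_gradient_le_of_mul_lt_infDist
      (continuous_totalViolation I fun i => (hF i).continuous) (totalViolation_nonneg I F)
      (fun y hy => hasGradientAt_totalViolation
        (fun i => ((hF i).differentiable one_ne_zero) y) (hpos y hy)) hk hx
    refine ⟨z, hzC, ?_, hz⟩
    have h1 : Metric.infDist x C ≤ dist x x₀ := Metric.infDist_le_dist_of_mem hx₀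
    have h2 : dist x x₀ < 1 / ((k : ℝ) + 1) := hxball
    calc dist z x₀ ≤ dist z x + dist x x₀ := dist_triangle _ _ _
      _ ≤ 1 / ((k : ℝ) + 1) + 1 / ((k : ℝ) + 1) := by linarith
      _ = 2 / ((k : ℝ) + 1) := by ring
  choose z hzC hzx hz using hstep
  have hlim0 : ∀ a : ℝ, Tendsto (fun k : ℕ => a / ((k : ℝ) + 1)) atTop (𝓝 0) := fun a => by
    simpa [div_eq_mul_inv] using (tendsto_one_div_add_atTop_nhds_zero_nat (𝕜 := ℝ)).const_mul a
  have hzlim : Tendsto z atTop (𝓝 x₀) :=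
    tendsto_iff_dist_tendsto_zero.2
      (squeeze_zero (fun _ => dist_nonneg) hzx (hlim0 2))
  -- Unit vectors, so a subsequence has a nonzero limit, the candidate multiplier.
  set u : ℕ → ι → ℝ := fun k i => violation I i (F i (z k)) / totalViolation I F (z k) with hu
  have husum : ∀ k, ∑ i, u k i ^ 2 = 1 := fun k => by
    simp only [hu, div_pow]
    rw [← Finset.sum_div, ← totalViolation_sq, div_self (pow_ne_zero 2 (hpos _ (hzC k)))]
  have hcomp : IsCompact {c : ι → ℝ | ∑ i, c i ^ 2 = 1} := by
    refine (isCompact_Icc (a := fun _ : ι => (-1 : ℝ)) (b := fun _ => 1)).of_isClosed_subset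
      (isClosed_eq (by fun_prop) continuous_const) fun c hc => ?_
    have habs : ∀ i, |c i| ≤ 1 := fun i => by
      rw [← sq_le_one_iff_abs_le_one, ← show ∑ i, c i ^ 2 = 1 from hc]
      exact Finset.single_le_sum (f := fun i => c i ^ 2) (fun _ _ => sq_nonneg _)
        (Finset.mem_univ i)
    exact ⟨fun i => (abs_le.1 (habs i)).1, fun i => (abs_le.1 (habs i)).2⟩
  obtain ⟨c, hc, ψ, hψ, hψlim⟩ := hcomp.tendsto_subseq (x := u) husum
  have hci : ∀ i, Tendsto (fun k => u (ψ k) i) atTop (𝓝 (c i)) := fun i =>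
    (tendsto_pi_nhds.1 hψlim) i
  have hzψ : Tendsto (fun k => z (ψ k)) atTop (𝓝 x₀) := hzlim.comp hψ.tendsto_atTop
  have hc0 : c ≠ 0 := by
    rintro rfl
    simp at hc
  have hcI : ∀ i ∈ I, 0 ≤ c i := fun i hi =>
    ge_of_tendsto' (hci i) fun k =>
      div_nonneg (violation_nonneg hi _) (totalViolation_nonneg _ _ _)
  have hcsum : ∑ i, c i • ∇ (F i) x₀ = 0 := by
    have hgrad : ∀ i, Continuous (∇ (F i)) := fun i =>
      (InnerProductSpace.toDual ℝ E).symm.continuous.comp ((hF i).continuous_fderiv one_ne_zero)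
    have h1 : Tendsto (fun k => ∑ i, u (ψ k) i • ∇ (F i) (z (ψ k))) atTop
        (𝓝 (∑ i, c i • ∇ (F i) x₀)) :=
      tendsto_finsetSum _ fun i _ => (hci i).smul (((hgrad i).tendsto x₀).comp hzψ)
    refine tendsto_nhds_unique h1 (squeeze_zero_norm (fun k => hz (ψ k)) ?_)
    exact (hlim0 4).comp hψ.tendsto_atTop
  -- `c i * u (ψ k) i` tends to `c i ^ 2 > 0`, and a nonzero violation equals the constraint value
  -- itself.
  have hev : ∀ᶠ k in atTop, ∀ i, c i ≠ 0 → 0 < c i * F i (z (ψ k)) := by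
    refine eventually_all.2 fun i => ?_
    by_cases hi : c i = 0
    · simp [hi]
    have h1 : Tendsto (fun k => c i * u (ψ k) i) atTop (𝓝 (c i * c i)) := (hci i).const_mul _
    filter_upwards [h1.eventually (lt_mem_nhds (mul_self_pos.2 hi))] with k hk _
    have hT : 0 < totalViolation I F (z (ψ k)) :=
      lt_of_le_of_ne (totalViolation_nonneg _ _ _) (hpos _ (hzC _)).symm
    simp only [hu] at hk
    rw [← mul_div_assoc, div_pos_iff_of_pos_right hT] at hk
    rwa [violation_eq_self (right_ne_zero_of_mul hk.ne')] at hk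
  obtain ⟨N, hN⟩ := eventually_atTop.1 hev
  exact hqn c hc0 hcI hcsum ⟨fun k => z (ψ (k + N)), hzψ.comp (tendsto_add_atTop_nat N),
    fun s => hN _ (Nat.le_add_left _ _)⟩

end ErrorBound

/-! ### Branch problems of the switching program -/

namespace MPSC

open Filter Topology
open scoped Gradient

variable {n m p l : ℕ} (P : MPSC n m p l)

/-- The constraint functions `g`, `h`, `G`, `H` as a single family. -/
def constraint : Fin m ⊕ Fin p ⊕ Fin l ⊕ Fin l → EuclideanSpace ℝ (Fin n) → ℝ
  | .inl i => P.g i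
  | .inr (.inl j) => P.h j
  | .inr (.inr (.inl k)) => P.G k
  | .inr (.inr (.inr k)) => P.H k

theorem contDiff_constraint (i) : ContDiff ℝ 2 (P.constraint i) := by
  rcases i with i | j | k | k
  exacts [P.contDiff_g i, P.contDiff_h j, P.contDiff_G k, P.contDiff_H k]

/-- The constraints of the branch problem that requires `G k = 0` for `k ∈ a` and `H k = 0` for
`k ∈ b`, with the inequality constraints restricted to `s`. -/
def branchIndices (s : Set (Fin m)) (a b : Set (Fin l)) : Set (Fin m ⊕ Fin p ⊕ Fin l ⊕ Fin l) :=
  {i | i.elim (· ∈ s) fun i => i.elim (fun _ => True) fun i => i.elim (· ∈ a) (· ∈ b)}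

section branchIndices

variable {s : Set (Fin m)} {a b : Set (Fin l)}

@[simp] theorem inl_mem_branchIndices {i} :
    (.inl i : Fin m ⊕ Fin p ⊕ Fin l ⊕ Fin l) ∈ branchIndices s a b ↔ i ∈ s := Iff.rfl

@[simp] theorem inr_inl_mem_branchIndices {j} :
    (.inr (.inl j) : Fin m ⊕ Fin p ⊕ Fin l ⊕ Fin l) ∈ branchIndices s a b := trivial

@[simp] theorem inr_inr_inl_mem_branchIndices {k} :
    (.inr (.inr (.inl k)) : Fin m ⊕ Fin p ⊕ Fin l ⊕ Fin l) ∈ branchIndices s a b ↔ k ∈ a :=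
  Iff.rfl

@[simp] theorem inr_inr_inr_mem_branchIndices {k} :
    (.inr (.inr (.inr k)) : Fin m ⊕ Fin p ⊕ Fin l ⊕ Fin l) ∈ branchIndices s a b ↔ k ∈ b :=
  Iff.rfl

end branchIndices

open Classical in
/-- The constraint functions of a branch problem, the others being replaced by zero. -/
noncomputable def branchConstraint (a b : Set (Fin l)) (i : Fin m ⊕ Fin p ⊕ Fin l ⊕ Fin l) :
    EuclideanSpace ℝ (Fin n) → ℝ :=
  if i ∈ branchIndices Set.univ a b then P.constraint i else 0

theorem branchGradients_eq_image (x₀ x : EuclideanSpace ℝ (Fin n)) (β₁ β₂ : Set (Fin l)) :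
    P.branchGradients x₀ β₁ β₂ x = (fun i => ∇ (P.constraint i) x) ''
      branchIndices (P.Ig x₀) (P.IG x₀ ∪ β₁) (P.IH x₀ ∪ β₂) := by
  ext y
  simp [branchGradients, constraint, or_assoc]

theorem differentiable_gradient_constraint (i) : Differentiable ℝ (∇ (P.constraint i)) :=
  (InnerProductSpace.toDual ℝ _).symm.toContinuousLinearEquiv.differentiable.comp
    (((P.contDiff_constraint i).fderiv_right (m := 1) (by norm_num)).differentiable one_ne_zero)

/-- Under the weak constant rank condition, first-order multipliers satisfy the second-order
condition of `IsBranchSOQNMultiplier` with equality. -/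
theorem BranchWCR.inner_sum_hessian_eq_zero {P : MPSC n m p l}
    {x₀ : EuclideanSpace ℝ (Fin n)} {β₁ β₂ : Set (Fin l)} (h : P.BranchWCR x₀ β₁ β₂)
    {c : Fin m ⊕ Fin p ⊕ Fin l ⊕ Fin l → ℝ}
    (hcs : ∀ i, i ∉ branchIndices (P.Ig x₀) (P.IG x₀ ∪ β₁) (P.IH x₀ ∪ β₂) → c i = 0)
    (hc : ∑ i, c i • ∇ (P.constraint i) x₀ = 0) {d : EuclideanSpace ℝ (Fin n)}
    (hd : d ∈ P.branchCriticalSubspace x₀ β₁ β₂) :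
    inner ℝ d (∑ i, c i • hessian (P.constraint i) x₀ d) = 0 := by
  obtain ⟨ε, hε, r, hr⟩ := h
  refine inner_sum_fderiv_eq_zero_of_finrank_eq (fun i => ∇ (P.constraint i))
    (branchIndices (P.Ig x₀) (P.IG x₀ ∪ β₁) (P.IH x₀ ∪ β₂))
    (fun i => P.differentiable_gradient_constraint i x₀) (r := r) ?_ hcs hc ?_
  · filter_upwards [Metric.ball_mem_nhds x₀ hε] with x hx
    rw [← branchGradients_eq_image]
    exact hr x hx
  · rintro (i | j | k | k) hi
    exacts [hd.1 i hi, hd.2.1 j, hd.2.2.1 k hi, hd.2.2.2 k hi]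

theorem contDiff_branchConstraint (a b : Set (Fin l)) (i) :
    ContDiff ℝ 1 (P.branchConstraint a b i) := by
  unfold branchConstraint
  split_ifs
  · exact (P.contDiff_constraint i).of_le one_le_two
  · exact contDiff_const

theorem IsBipartition.vanish {P : MPSC n m p l} {x₀ : EuclideanSpace ℝ (Fin n)}
    {β₁ β₂ : Set (Fin l)} (hβ : P.IsBipartition x₀ β₁ β₂) :
    (∀ k ∈ P.IG x₀ ∪ β₁, P.G k x₀ = 0) ∧ ∀ k ∈ P.IH x₀ ∪ β₂, P.H k x₀ = 0 := by
  refine ⟨fun k hk => hk.elim (fun h => h.1) fun h => ?_,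
    fun k hk => hk.elim (fun h => h.2) fun h => ?_⟩
  · exact (hβ.1 ▸ Or.inl h : k ∈ P.IGH x₀).1
  · exact (hβ.1 ▸ Or.inr h : k ∈ P.IGH x₀).2

theorem violation_branchConstraint_eq_zero {P : MPSC n m p l} {x₀ : EuclideanSpace ℝ (Fin n)}
    (hx₀ : x₀ ∈ P.feasible) {a b : Set (Fin l)} (ha : ∀ k ∈ a, P.G k x₀ = 0)
    (hb : ∀ k ∈ b, P.H k x₀ = 0) (i) :
    violation (Set.range Sum.inl) i (P.branchConstraint a b i x₀) = 0 := by
  rcases i with i | j | k | k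
  · simpa [violation, branchConstraint, constraint] using hx₀.1 i
  · simpa [violation, branchConstraint, constraint] using hx₀.2.1 j
  · by_cases hk : k ∈ a <;>
      simp_all [violation, branchConstraint, constraint]
  · by_cases hk : k ∈ b <;>
      simp_all [violation, branchConstraint, constraint]

/-- The local error bound for a branch problem. -/
theorem eventually_infDist_branch_le {P : MPSC n m p l} {x₀ : EuclideanSpace ℝ (Fin n)}
    (hx₀ : x₀ ∈ P.feasible) {β₁ β₂ : Set (Fin l)} (hβ : P.IsBipartition x₀ β₁ β₂)
    (hwcr : P.BranchWCR x₀ β₁ β₂) (hqn : P.BranchSOQN x₀ β₁ β₂) :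
    ∃ α > 0, ∀ᶠ x in 𝓝 x₀,
      Metric.infDist x {y | ∀ i, violation (Set.range Sum.inl) i
        (P.branchConstraint (P.IG x₀ ∪ β₁) (P.IH x₀ ∪ β₂) i y) = 0} ≤
      α * totalViolation (Set.range Sum.inl)
        (P.branchConstraint (P.IG x₀ ∪ β₁) (P.IH x₀ ∪ β₂)) x := by
  set a := P.IG x₀ ∪ β₁ with ha
  set b := P.IH x₀ ∪ β₂ with hb
  refine eventually_infDist_le_of_quasinormal _ (P.contDiff_branchConstraint a b)
    (violation_branchConstraint_eq_zero hx₀ hβ.vanish.1 hβ.vanish.2) ?_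
  rintro c hc0 hcI hcsum ⟨x, hx, hxs⟩
  -- A constraint replaced by zero cannot satisfy the strict sign condition, so its multiplier
  -- vanishes.
  have hoff : ∀ i, i ∉ branchIndices Set.univ a b → c i = 0 := fun i hi => by
    by_contra hci
    simpa [branchConstraint, hi] using hxs 0 i hci
  have hon : ∀ i, c i ≠ 0 → P.branchConstraint a b i = P.constraint i := fun i hci =>
    if_pos (by_contra fun hi => hci (hoff i hi))
  have hseq : ∀ s i, c i ≠ 0 → 0 < c i * P.constraint i (x s) := fun s i hci => by
    rw [← hon i hci]; exact hxs s i hci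
  have hsum : ∑ i, c i • ∇ (P.constraint i) x₀ = 0 := by
    rw [← hcsum]
    refine Finset.sum_congr rfl fun i _ => ?_
    by_cases hci : c i = 0
    · simp [hci]
    · rw [hon i hci]
  -- A positive multiplier forces `P.g i > 0` along a sequence tending to `x₀`, hence activity at
  -- `x₀`.
  have hactive : ∀ i, i ∉ P.Ig x₀ → c (.inl i) = 0 := fun i hi => by
    by_contra hci
    have hcpos : 0 < c (.inl i) := lt_of_le_of_ne (hcI _ ⟨i, rfl⟩) (Ne.symm hci)
    have hge : 0 ≤ P.g i x₀ := ge_of_tendsto' (((P.contDiff_g i).continuous.tendsto x₀).comp hx)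
      fun s => (pos_of_mul_pos_right (hseq s (.inl i) hci) hcpos.le).le
    exact hi (le_antisymm (hx₀.1 i) hge)
  have hcs : ∀ i, i ∉ branchIndices (P.Ig x₀) a b → c i = 0 := by
    rintro (i | j | k | k) hi
    exacts [hactive i hi, hoff _ hi, hoff _ hi, hoff _ hi]
  refine hqn ⟨fun i => c (.inl i), fun j => c (.inr (.inl j)), fun k => c (.inr (.inr (.inl k))),
    fun k => c (.inr (.inr (.inr k))), fun h => hc0 ?_, ?_⟩
  · simp only [Prod.mk_eq_zero, funext_iff, Pi.zero_apply] at h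
    funext i
    rcases i with i | j | k | k
    exacts [h.1 i, h.2.1 j, h.2.2.1 k, h.2.2.2 k]
  · refine ⟨fun k hk => hoff _ hk, fun k hk => hoff _ hk, fun i => hcI _ ⟨i, rfl⟩, ?_, ?_,
      x, hx, fun s => ⟨fun i hi => hseq s _ hi.ne', fun j => hseq s _, fun k => hseq s _,
        fun k => hseq s _⟩⟩
    · simpa [Fintype.sum_sum_type, constraint, add_assoc] using hsum
    · intro d hd
      have := hwcr.inner_sum_hessian_eq_zero hcs hsum hd
      simp only [Fintype.sum_sum_type, constraint, ← add_assoc] at this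
      simp only [add_apply, sum_apply,
        smul_apply]
      exact this.ge

theorem branch_subset_feasible {P : MPSC n m p l} {a b : Set (Fin l)} (hab : ∀ k, k ∈ a ∨ k ∈ b) :
    {y | ∀ i, violation (Set.range Sum.inl) i (P.branchConstraint a b i y) = 0} ⊆
      P.feasible := by
  refine fun y hy => ⟨fun i => ?_, fun j => ?_, fun k => ?_⟩
  · simpa [violation, branchConstraint, constraint] using hy (.inl i)
  · simpa [violation, branchConstraint, constraint] using
      hy (.inr (.inl j))
  · rcases hab k with hk | hk
    · have := hy (.inr (.inr (.inl k)))
      rw [violation, if_neg (by simp), branchConstraint, if_pos (by simpa using hk)] at this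
      exact mul_eq_zero_of_left this _
    · have := hy (.inr (.inr (.inr k)))
      rw [violation, if_neg (by simp), branchConstraint, if_pos (by simpa using hk)] at this
      exact mul_eq_zero_of_right _ this

theorem IsBipartition.mem_or_mem {P : MPSC n m p l} {x₀ : EuclideanSpace ℝ (Fin n)}
    (hx₀ : x₀ ∈ P.feasible) {β₁ β₂ : Set (Fin l)} (hβ : P.IsBipartition x₀ β₁ β₂) (k : Fin l) :
    k ∈ P.IG x₀ ∪ β₁ ∨ k ∈ P.IH x₀ ∪ β₂ := by
  have h1 : k ∈ β₁ ∪ β₂ ↔ k ∈ P.IGH x₀ := by rw [hβ.1]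
  have h2 := mul_eq_zero.1 (hx₀.2.2 k)
  simp only [Set.mem_union, IG, IH, IGH, Set.mem_ofPred_eq] at *
  tauto

/-- The violation of the branch problem that is nearest at `x` is bounded by the residual. -/
theorem totalViolation_branch_le_residual {P : MPSC n m p l} {a b : Set (Fin l)}
    {x : EuclideanSpace ℝ (Fin n)} (hab : Disjoint a b)
    (ha : ∀ k ∈ a, P.G k x ^ 2 ≤ P.H k x ^ 2) (hb : ∀ k ∈ b, P.H k x ^ 2 ≤ P.G k x ^ 2) :
    totalViolation (Set.range Sum.inl) (P.branchConstraint a b) x ≤ P.residual x := by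
  classical
  refine Real.sqrt_le_sqrt ?_
  simp only [Fintype.sum_sum_type, ← add_assoc]
  -- The `G` and `H` sums are merged because the residual has a single minimum per `k`; by
  -- disjointness at most one of the two terms is nonzero.
  rw [add_assoc (_ + _), ← Finset.sum_add_distrib]
  refine add_le_add (add_le_add (Finset.sum_le_sum fun i _ => ?_)
    (Finset.sum_le_sum fun j _ => ?_)) (Finset.sum_le_sum fun k _ => ?_)
  · simp [violation, branchConstraint, constraint]
  · simp [violation, branchConstraint, constraint]
  · have hG : P.branchConstraint a b (.inr (.inr (.inl k))) x = if k ∈ a then P.G k x else 0 := by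
      simp [branchConstraint, ite_apply, constraint]
    have hH : P.branchConstraint a b (.inr (.inr (.inr k))) x = if k ∈ b then P.H k x else 0 := by
      simp [branchConstraint, ite_apply, constraint]
    rw [hG, hH]
    simp only [violation, Set.mem_range, reduceCtorEq, exists_false, if_false]
    by_cases hka : k ∈ a
    · have hkb : k ∉ b := Set.disjoint_left.1 hab hka
      simp [hka, hkb, ha k hka]
    · by_cases hkb : k ∈ b
      · simp [hka, hkb, hb k hkb]
      · simp [hka, hkb, sq_nonneg]

end MPSC

/-! ### Gluing the branch error bounds -/

open Filter Topology in
theorem theorem6p2 {n m p l : ℕ} (P : MPSC n m p l) (x₀ : EuclideanSpace ℝ (Fin n))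
    (hx₀ : x₀ ∈ P.feasible) (hPWCR : P.PWCR x₀) (hPSOQN : P.PSOQN x₀) :
    P.LocalErrorBound x₀ := by
  have hbranch : ∀ β : Set (Fin l) × Set (Fin l), ∃ α > 0, P.IsBipartition x₀ β.1 β.2 →
      ∀ᶠ x in 𝓝 x₀, Metric.infDist x P.feasible ≤ α * totalViolation (Set.range Sum.inl)
        (P.branchConstraint (P.IG x₀ ∪ β.1) (P.IH x₀ ∪ β.2)) x := by
    intro β
    by_cases hβ : P.IsBipartition x₀ β.1 β.2
    · obtain ⟨α, hα, h⟩ := MPSC.eventually_infDist_branch_le hx₀ hβ (hPWCR _ _ hβ) (hPSOQN _ _ hβ)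
      refine ⟨α, hα, fun _ => h.mono fun x hx => le_trans ?_ hx⟩
      exact Metric.infDist_le_infDist_of_subset
        (MPSC.branch_subset_feasible (hβ.mem_or_mem hx₀))
        ⟨x₀, MPSC.violation_branchConstraint_eq_zero hx₀ hβ.vanish.1 hβ.vanish.2⟩
    -- A dummy constant makes `α` total on the finite type of pairs, so that it has an upper bound.
    · exact ⟨1, one_pos, fun h => absurd h hβ⟩
  choose α hα hbound using hbranch
  obtain ⟨A, hA⟩ := (Set.finite_range α).bddAbove
  have hA' : ∀ β, α β ≤ A := fun β => hA ⟨β, rfl⟩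
  have hev : ∀ᶠ x in 𝓝 x₀, ∀ β : Set (Fin l) × Set (Fin l), P.IsBipartition x₀ β.1 β.2 →
      Metric.infDist x P.feasible ≤ α β * totalViolation (Set.range Sum.inl)
        (P.branchConstraint (P.IG x₀ ∪ β.1) (P.IH x₀ ∪ β.2)) x :=
    eventually_all.2 fun β => by
      by_cases hβ : P.IsBipartition x₀ β.1 β.2
      · exact (hbound β hβ).mono fun x hx _ => hx
      · exact .of_forall fun _ h => absurd h hβ
  have hcont : ∀ k, Continuous (fun x => P.G k x ^ 2) ∧ Continuous (fun x => P.H k x ^ 2) :=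
    fun k => ⟨(P.contDiff_G k).continuous.pow 2, (P.contDiff_H k).continuous.pow 2⟩
  -- Outside `IGH` the factor vanishing at `x₀` stays the smaller one nearby, by continuity.
  have hIG : ∀ᶠ x in 𝓝 x₀, ∀ k, k ∈ P.IG x₀ → P.G k x ^ 2 ≤ P.H k x ^ 2 :=
    eventually_all.2 fun k => by
      by_cases hk : k ∈ P.IG x₀
      · have hlt : P.G k x₀ ^ 2 < P.H k x₀ ^ 2 := by
          rw [hk.1]; simpa using pow_pos (sq_pos_of_ne_zero hk.2) 1
        exact ((hcont k).1.continuousAt.eventually_lt (hcont k).2.continuousAt hlt).mono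
          fun x hx _ => hx.le
      · exact .of_forall fun _ h => absurd h hk
  have hIH : ∀ᶠ x in 𝓝 x₀, ∀ k, k ∈ P.IH x₀ → P.H k x ^ 2 ≤ P.G k x ^ 2 :=
    eventually_all.2 fun k => by
      by_cases hk : k ∈ P.IH x₀
      · have hlt : P.H k x₀ ^ 2 < P.G k x₀ ^ 2 := by
          rw [hk.2]; simpa using pow_pos (sq_pos_of_ne_zero hk.1) 1
        exact ((hcont k).2.continuousAt.eventually_lt (hcont k).1.continuousAt hlt).mono
          fun x hx _ => hx.le
      · exact .of_forall fun _ h => absurd h hk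
  obtain ⟨ε, hε, hball⟩ := Metric.eventually_nhds_iff_ball.1 (hev.and (hIG.and hIH))
  refine ⟨ε, hε, A, (hα (∅, ∅)).trans_le (hA' _), fun x hx => ?_⟩
  obtain ⟨h1, h2, h3⟩ := hball x hx
  -- The branch depends on `x`, hence the need for a constant `A` and a radius `ε` common to all
  -- branches.
  set S : Set (Fin l) := {k | P.G k x ^ 2 ≤ P.H k x ^ 2} with hS
  have hβ : P.IsBipartition x₀ (P.IGH x₀ ∩ S) (P.IGH x₀ \ S) :=
    ⟨Set.inter_union_sdiff _ _, Set.disjoint_left.2 fun k hk hk' => hk'.2 hk.2⟩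
  calc Metric.infDist x P.feasible
      ≤ α (P.IGH x₀ ∩ S, P.IGH x₀ \ S) * totalViolation (Set.range Sum.inl)
        (P.branchConstraint (P.IG x₀ ∪ P.IGH x₀ ∩ S) (P.IH x₀ ∪ P.IGH x₀ \ S)) x := h1 _ hβ
    _ ≤ A * totalViolation (Set.range Sum.inl)
        (P.branchConstraint (P.IG x₀ ∪ P.IGH x₀ ∩ S) (P.IH x₀ ∪ P.IGH x₀ \ S)) x :=
      mul_le_mul_of_nonneg_right (hA' _) (totalViolation_nonneg _ _ _)
    _ ≤ A * P.residual x := by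
      refine mul_le_mul_of_nonneg_left (MPSC.totalViolation_branch_le_residual ?_ ?_ ?_)
        ((hα (∅, ∅)).le.trans (hA' _))
      · refine Set.disjoint_left.2 ?_
        rintro k (hk | hk) (hk' | hk')
        exacts [hk.2 hk'.2, hk.2 hk'.1.2, hk'.1 hk.1.1, hk'.2 hk.2]
      · rintro k (hk | hk)
        exacts [h2 k hk, hk.2]
      · rintro k (hk | hk)
        exacts [h3 k hk, (not_le.1 hk.2).le]
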